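/- **Conventions.** Let $\otimes$ be either multiplication $u\otimes v=uv$ or the Łukasiewicz tensor $u\otimes v=\max(0,u+v-1)$ on $[0,1]$, and let $\hom(u,-)$ be the right adjoint of $u\otimes-$, so that $u\otimes v\le w\iff v\le\hom(u,w)$. A *$[0,1]$-category* is a set $X$ with a map $a:X\times X\to[0,1]$ such that $a(x,x)=1$ and $a(x,y)\otimes a(y,z)\le a(x,z)$. A *$[0,1]$-functor* $f:(X,a)\to(Y,b)$ satisfies $a(x,y)\le b(f(x),f(y))$. $(X,a)$ is *separated* if $a(x,y)=a(y,x)=1$ implies $x=y$. A *distributor* $\psi:D\to G$ from a $[0,1]$-category $(D,d)$ to the one-point $[0,1]$-category $G$ is a map $\psi:D\to[0,1]$ with $d(z,z')\otimes\psi(z')\le\psi(z)$. It is *right adjoint* if there is $\varphi:D\to[0,1]$ with $\varphi(z)\otimes d(z,z')\le\varphi(z')$, $\bigvee_z\varphi(z)\otimes\psi(z)=1$ and $\psi(z)\otimes\varphi(z')\le d(z,z')$. A *colimit* in $(X,a)$ of a $[0,1]$-functor $h:D\to X$ weighted by $\psi$ is an element $x_0\in X$ with $a(x_0,x)=\inf_{z\in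 D}\hom(\psi(z),a(h(z),x))$ for all $x\in X$. $X$ is *finitely cocomplete* if all such colimits with $D$ finite exist, and a $[0,1]$-functor is *finitely cocontinuous* if it preserves them. $X$ is *Cauchy-complete* if all such colimits with $\psi$ right adjoint exist. A *$u$-power* of $x$ is an element $p$ with $\hom(u,a(y,x))=a(y,p)$ for all $y$; $X$ is *powered* if all $u$-powers ($u\in[0,1]$) exist. **The category $\mathsf A$.** For the Łukasiewicz tensor, an object of $\mathsf A$ is a separated, finitely cocomplete, powered $[0,1]$-category with an associative and commutative operation whose unit $1$ is the top element and for which multiplication by each element is a finitely cocontinuous $[0,1]$-functor. A morphism of $\mathsf A$ is a finitely cocontinuous $[0,1]$-functor that preserves the multiplication, the unit and the powers. For $\otimes$ the multiplication, the objects carry in addition an action $\ominus$ of the monoid $[0,1]$ with truncated addition (that is, $x\ominus0=x$ and $(x\ominus u)\ominus v=x\ominus\min(1,u+v)$), and morphisms also preserve $\ominus$. **The object $CX$.** A *partially ordered compact space* is a compact space $X$ with a partial order that is closed in $X\times X$; morphisms of these are the monotone continuous maps, and $[0,1]^{\mathrm{op}}$ denotes $[0,1]$ with the Euclidean topology and the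 order $\ge$. For such $X$, $CX$ is the set of all morphisms $X\to[0,1]^{\mathrm{op}}$ (that is, all antitone continuous $\psi:X\to[0,1]$) with $d(\psi,\psi')=\inf_{x\in X}\hom(\psi(x),\psi'(x))$, the pointwise tensor as multiplication, the constant function $1$ as unit and, when $\otimes$ is multiplication, the pointwise truncated minus $(\psi\ominus u)(x)=\max(0,\psi(x)-u)$; it is an object of $\mathsf A$. **Theorem.** Let $X$ be a partially ordered compact space and let $m:A\to CX$ be an injective morphism in $\mathsf A$. Assume that the cone $(m(a):X\to[0,1]^{\mathrm{op}})_{a\in A}$ is point-separating (if $m(a)(x)=m(a)(y)$ for all $a\in A$, then $x=y$) and initial with respect to the forgetful functor from partially ordered compact spaces to sets (for every partially ordered compact space $Y$, a map $f:Y\to X$ is monotone and continuous as soon as every composite $m(a)\circ f:Y\to[0,1]^{\mathrm{op}}$ is monotone and continuous). Then $m$ is an isomorphism in $\mathsf A$ if and only if $A$ is Cauchy-complete. -/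

import Mathlib

open CategoryTheory

universe u

local notation "𝕀" => Set.Elem unitInterval

/-! ### Continuous quantale structures on the unit interval -/

/-- A quantale structure on the complete lattice `[0,1]` with neutral element `1` and continuous
tensor, that is, a continuous t-norm. -/
structure TNorm where
  tensor : 𝕀 → 𝕀 → 𝕀
  tensor_assoc : ∀ u v w, tensor (tensor u v) w = tensor u (tensor v w)
  tensor_comm : ∀ u v, tensor u v = tensor v u
  tensor_one : ∀ u, tensor u 1 = u
  tensor_sSup : ∀ u (S : Set 𝕀), tensor u (sSup S) = ⨆ v ∈ S, tensor u v
  continuous_tensor : Continuous fun p : 𝕀 × 𝕀 => tensor p.1 p.2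

namespace TNorm

variable (T : TNorm)

/-- The internal hom of the quantale: `hom u` is right adjoint to `u ⊗ -`, see
`TNorm.le_hom_iff`. -/
noncomputable def hom (u v : 𝕀) : 𝕀 := sSup {w | T.tensor u w ≤ v}

theorem tensor_mono_right (u : 𝕀) : Monotone (T.tensor u) := by
  intro v w h
  have h2 := T.tensor_sSup u {v, w}
  rw [sSup_pair, sup_eq_right.2 h] at h2
  rw [h2]
  exact le_iSup₂_of_le v (by simp) le_rfl

theorem tensor_mono {u u' v v' : 𝕀} (h : u ≤ u') (h' : v ≤ v') :
    T.tensor u v ≤ T.tensor u' v' := by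
  refine (T.tensor_mono_right u h').trans ?_
  rw [T.tensor_comm u, T.tensor_comm u']
  exact T.tensor_mono_right v' h

theorem le_hom_iff {u v w : 𝕀} : w ≤ T.hom u v ↔ T.tensor u w ≤ v := by
  constructor
  · intro h
    refine (T.tensor_mono_right u h).trans ?_
    rw [hom, T.tensor_sSup]
    exact iSup₂_le fun _ hx => hx
  · intro h
    exact le_sSup h

theorem iSup_tensor {ι : Sort*} (f : ι → 𝕀) (u : 𝕀) :
    T.tensor (⨆ i, f i) u = ⨆ i, T.tensor (f i) u := by
  rw [T.tensor_comm, iSup, T.tensor_sSup, iSup_range]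
  simp only [T.tensor_comm u]

theorem hom_mono_right (u : 𝕀) : Monotone (T.hom u) := fun _ _ h =>
  T.le_hom_iff.2 ((T.le_hom_iff.1 le_rfl).trans h)

/-- A tensor that is continuous, monotone and has `0` as absorbing element preserves suprema. -/
theorem sSup_of_continuous {f : 𝕀 → 𝕀 → 𝕀} (hc : Continuous fun p : 𝕀 × 𝕀 => f p.1 p.2)
    (u : 𝕀) (hm : Monotone (f u)) (h0 : f u 0 = 0) (S : Set 𝕀) :
    f u (sSup S) = ⨆ v ∈ S, f u v := by
  have hc' : Continuous (f u) := hc.comp (Continuous.prodMk_right u)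
  rw [hm.map_sSup_of_continuousAt hc'.continuousAt h0, sSup_image]

/-- Multiplication. -/
noncomputable def multiplication : TNorm where
  tensor u v := u * v
  tensor_assoc := mul_assoc
  tensor_comm := mul_comm
  tensor_one := mul_one
  continuous_tensor := by fun_prop
  tensor_sSup u S := sSup_of_continuous (f := fun u v => u * v) (by fun_prop) u
    (fun v w h => mul_le_mul_right h u) (mul_zero u) S

/-- `u ⊙ v = max(0, u + v - 1)`. -/
noncomputable def lukFun (u v : 𝕀) : 𝕀 :=
  ⟨max 0 ((u : ℝ) + v - 1), le_max_left _ _,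
    max_le zero_le_one (by linarith [u.2.2, v.2.2])⟩

theorem continuous_lukFun : Continuous fun p : 𝕀 × 𝕀 => lukFun p.1 p.2 := by
  unfold lukFun; fun_prop

/-- The Łukasiewicz tensor. -/
noncomputable def lukasiewicz : TNorm where
  tensor := lukFun
  tensor_assoc u v w := by
    have hu := u.2.2
    have hw := w.2.2
    apply Subtype.ext
    simp only [lukFun]
    rcases max_cases (0 : ℝ) ((u : ℝ) + v - 1) with h | h <;>
    rcases max_cases (0 : ℝ) ((v : ℝ) + w - 1) with h' | h' <;>
    rw [h.1, h'.1] <;> grind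
  tensor_comm u v := by
    apply Subtype.ext
    simp only [lukFun, add_comm]
  tensor_one u := by
    apply Subtype.ext
    simp [lukFun, u.2.1]
  continuous_tensor := continuous_lukFun
  tensor_sSup u S := by
    refine sSup_of_continuous continuous_lukFun u ?_ ?_ S
    · intro v w h
      have h' : (v : ℝ) ≤ w := h
      exact Subtype.mk_le_mk.2 (max_le_max le_rfl (by linarith))
    · apply Subtype.ext
      simp [lukFun, u.2.2]

theorem continuous_hom_multiplication (u : 𝕀) : Continuous (multiplication.hom u) := by
  by_cases hu : u = 0
  · have : multiplication.hom u = fun _ => 1 := by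
      funext v
      refine le_antisymm unitInterval.le_one' (le_hom_iff _ |>.2 ?_)
      simp [multiplication, hu]
    rw [this]; exact continuous_const
  · have hu' : (0 : ℝ) < u := lt_of_le_of_ne u.2.1 fun h => hu (Subtype.ext h.symm)
    have : multiplication.hom u = fun v : 𝕀 =>
        (⟨min 1 ((v : ℝ) / u), le_min zero_le_one (div_nonneg v.2.1 u.2.1),
          min_le_left _ _⟩ : 𝕀) := by
      funext v
      refine eq_of_forall_le_iff fun w => ?_
      rw [le_hom_iff, ← Subtype.coe_le_coe, ← Subtype.coe_le_coe]
      simp only [multiplication, Set.Icc.coe_mul, le_min_iff, w.2.2, true_and]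
      rw [le_div_iff₀ hu', mul_comm]
    rw [this]
    fun_prop

theorem continuous_hom_lukasiewicz (u : 𝕀) : Continuous (lukasiewicz.hom u) := by
  have : lukasiewicz.hom u = fun v : 𝕀 =>
      (⟨min 1 (1 - (u : ℝ) + v), le_min zero_le_one (by linarith [u.2.2, v.2.1]),
        min_le_left _ _⟩ : 𝕀) := by
    funext v
    refine eq_of_forall_le_iff fun w => ?_
    rw [le_hom_iff, ← Subtype.coe_le_coe, ← Subtype.coe_le_coe]
    simp only [lukasiewicz, lukFun, le_min_iff, w.2.2, true_and, max_le_iff, v.2.1]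
    constructor <;> intro h <;> linarith
  rw [this]
  fun_prop

end TNorm

/-- Truncated addition `u ⊕ v = min(1, u + v)` on `[0,1]`. -/
noncomputable def truncAdd (u v : 𝕀) : 𝕀 :=
  ⟨min 1 ((u : ℝ) + v), le_min zero_le_one (add_nonneg u.2.1 v.2.1), min_le_left _ _⟩

/-- Truncated minus `u ⊖ v = max(0, u - v)` on `[0,1]`. -/
noncomputable def truncSub (u v : 𝕀) : 𝕀 :=
  ⟨max 0 ((u : ℝ) - v), le_max_left _ _, max_le zero_le_one (by linarith [u.2.2, v.2.1])⟩

/-! ### Categories enriched in the quantale -/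

/-- A `[0,1]`-category structure on a set, with respect to the tensor `T`. -/
class VCategory (T : TNorm) (X : Type u) where
  d : X → X → 𝕀
  one_le_d : ∀ x, 1 ≤ d x x
  d_tensor_d_le : ∀ x y z, T.tensor (d x y) (d y z) ≤ d x z

/-- The one-point `[0,1]`-category `G = (1, k)`. -/
instance (T : TNorm) : VCategory T Unit where
  d _ _ := 1
  one_le_d _ := le_rfl
  d_tensor_d_le _ _ _ := (T.tensor_one 1).le

section VCategory

variable (T : TNorm)

open VCategory (d)

/-- Composite `s · r` of the `[0,1]`-relations `r : X ⇸ Y` and `s : Y ⇸ Z`. -/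
noncomputable def vcomp {X Y Z : Type*} (s : Y → Z → 𝕀) (r : X → Y → 𝕀) (x : X) (z : Z) : 𝕀 :=
  ⨆ y, T.tensor (r x y) (s y z)

/-- A `[0,1]`-relation between `[0,1]`-categories is a distributor if it is compatible with the
structures: `r · a ≤ r` and `b · r ≤ r`. -/
def IsDistributor {X Y : Type*} [VCategory T X] [VCategory T Y] (r : X → Y → 𝕀) : Prop :=
  (∀ x y, vcomp T r (d T) x y ≤ r x y) ∧ (∀ x y, vcomp T (d T) r x y ≤ r x y)

/-- The distributor `ψ : Y ⇸ X` is right adjoint: there is a distributor `φ : X ⇸ Y` with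
`1_X ≤ ψ · φ` and `φ · ψ ≤ 1_Y`; the identity distributor of a `[0,1]`-category is its
structure. -/
def IsRightAdjointDistributor {X Y : Type*} [VCategory T X] [VCategory T Y]
    (ψ : Y → X → 𝕀) : Prop :=
  IsDistributor T ψ ∧ ∃ φ : X → Y → 𝕀, IsDistributor T φ ∧
    (∀ x x', d T x x' ≤ vcomp T ψ φ x x') ∧ (∀ y y', vcomp T φ ψ y y' ≤ d T y y')

/-- `[0,1]`-functors. -/
def IsVFunctor {X Y : Type*} [VCategory T X] [VCategory T Y] (f : X → Y) : Prop :=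
  ∀ x y, d T x y ≤ d T (f x) (f y)

/-- `x₀` is a colimit of the weighted colimit diagram `h : D → X`, `ψ : D ⇸ G`. -/
def IsWeightedColimit {D X : Type*} [VCategory T X] (h : D → X) (ψ : D → Unit → 𝕀)
    (x₀ : X) : Prop :=
  ∀ x, d T x₀ x = ⨅ z, T.hom (ψ z ()) (d T (h z) x)

/-- A `[0,1]`-category is separated if its natural order (`x ≤ y` iff `1 ≤ d x y`) is
anti-symmetric. -/
def IsSeparated (X : Type*) [VCategory T X] : Prop :=
  ∀ x y : X, 1 ≤ d T x y → 1 ≤ d T y x → x = y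

/-- Every weighted colimit diagram indexed by a finite `[0,1]`-category has a colimit. -/
def IsFinitelyCocomplete (X : Type u) [VCategory T X] : Prop :=
  ∀ (D : Type u) [VCategory T D] [Finite D] (h : D → X) (ψ : D → Unit → 𝕀),
    IsVFunctor T h → IsDistributor T ψ → ∃ x₀, IsWeightedColimit T h ψ x₀

/-- A `[0,1]`-functor that preserves the colimits of all weighted colimit diagrams indexed by
finite `[0,1]`-categories. -/
def IsFinitelyCocontinuous {X Y : Type u} [VCategory T X] [VCategory T Y] (f : X → Y) : Prop :=
  IsVFunctor T f ∧
    ∀ (D : Type u) [VCategory T D] [Finite D] (h : D → X) (ψ : D → Unit → 𝕀),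
      IsVFunctor T h → IsDistributor T ψ →
        ∀ x₀, IsWeightedColimit T h ψ x₀ → IsWeightedColimit T (f ∘ h) ψ (f x₀)

/-- Every weighted colimit diagram whose weight is a right adjoint distributor has a colimit. -/
def IsCauchyComplete (X : Type u) [VCategory T X] : Prop :=
  ∀ (D : Type u) [VCategory T D] (h : D → X) (ψ : D → Unit → 𝕀),
    IsVFunctor T h → IsRightAdjointDistributor T ψ → ∃ x₀, IsWeightedColimit T h ψ x₀

/-- `p` is a `u`-power of `x`. -/
def IsPower {X : Type*} [VCategory T X] (x : X) (u : 𝕀) (p : X) : Prop :=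
  ∀ y, T.hom u (d T y x) = d T y p

/-- A `[0,1]`-category is powered if it has all `u`-powers. -/
def IsPowered (X : Type*) [VCategory T X] : Prop :=
  ∀ (x : X) (u : 𝕀), ∃ p, IsPower T x u p

theorem IsFinitelyCocontinuous.id (X : Type u) [VCategory T X] :
    IsFinitelyCocontinuous T (fun x : X => x) :=
  ⟨fun _ _ => le_rfl, fun _ _ _ _ _ _ _ _ h => h⟩

theorem IsFinitelyCocontinuous.comp {X Y Z : Type u} [VCategory T X] [VCategory T Y]
    [VCategory T Z] {g : Y → Z} {f : X → Y} (hg : IsFinitelyCocontinuous T g)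
    (hf : IsFinitelyCocontinuous T f) : IsFinitelyCocontinuous T (fun x => g (f x)) :=
  ⟨fun x y => (hf.1 x y).trans (hg.1 _ _), fun D _ _ h ψ hh hψ x₀ hx =>
    hg.2 D (f ∘ h) ψ (fun x y => (hh x y).trans (hf.1 _ _)) hψ _ (hf.2 D h ψ hh hψ x₀ hx)⟩

end VCategory

/-! ### Monoids in finitely cocomplete `[0,1]`-categories -/

/-- Commutative monoids in the category of separated finitely cocomplete `[0,1]`-categories: the
unit is the top element, and every `x ⊛ -` is a finitely cocontinuous `[0,1]`-functor. -/
structure MonFinSup (T : TNorm) where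
  carrier : Type u
  [str : VCategory T carrier]
  separated : IsSeparated T carrier
  finitelyCocomplete : IsFinitelyCocomplete T carrier
  mul : carrier → carrier → carrier
  one : carrier
  mul_assoc : ∀ x y z, mul (mul x y) z = mul x (mul y z)
  mul_comm : ∀ x y, mul x y = mul y x
  mul_one : ∀ x, mul x one = x
  le_one : ∀ x, 1 ≤ VCategory.d T x one
  finitelyCocontinuous_mul : ∀ x, IsFinitelyCocontinuous T (mul x)

attribute [instance] MonFinSup.str

/-- Finitely cocontinuous `[0,1]`-functors preserving unit and multiplication. -/
structure MonFinSup.IsHom {T : TNorm} (A B : MonFinSup.{u} T) (f : A.carrier → B.carrier) :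
    Prop where
  finitelyCocontinuous : IsFinitelyCocontinuous T f
  map_one : f A.one = B.one
  map_mul : ∀ x y, f (A.mul x y) = B.mul (f x) (f y)

/-- Commutative monoids as above together with an action `⊖` of the monoid
`([0,1], ⊕, 0)`, where `⊕` is truncated addition. -/
structure MonFinSupMinus (T : TNorm) extends MonFinSup.{u} T where
  ominus : carrier → 𝕀 → carrier
  ominus_zero : ∀ x, ominus x 0 = x
  ominus_ominus : ∀ x u v, ominus (ominus x u) v = ominus x (truncAdd u v)

/-- Objects: the `[0,1]`-powered objects of the category of commutative monoids in separated
finitely cocomplete `[0,1]`-categories. -/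
structure PowMon (T : TNorm) extends MonFinSup.{u} T where
  powered : IsPowered T carrier

/-- Objects: the `[0,1]`-powered objects of the category of commutative monoids in separated
finitely cocomplete `[0,1]`-categories with an action `⊖`. -/
structure PowMonMinus (T : TNorm) extends MonFinSupMinus.{u} T where
  powered : IsPowered T carrier

/-- Morphisms: the monoid homomorphisms that preserve powers. -/
@[ext] structure PowMon.Hom {T : TNorm} (A B : PowMon.{u} T) where
  toFun : A.carrier → B.carrier
  isHom : MonFinSup.IsHom A.toMonFinSup B.toMonFinSup toFun
  map_power : ∀ x u p, IsPower T x u p → IsPower T (toFun x) u (toFun p)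

/-- Morphisms: the monoid homomorphisms that preserve the action `⊖` and powers. -/
@[ext] structure PowMonMinus.Hom {T : TNorm} (A B : PowMonMinus.{u} T) where
  toFun : A.carrier → B.carrier
  isHom : MonFinSup.IsHom A.toMonFinSup B.toMonFinSup toFun
  map_ominus : ∀ x u, toFun (A.ominus x u) = B.ominus (toFun x) u
  map_power : ∀ x u p, IsPower T x u p → IsPower T (toFun x) u (toFun p)

theorem MonFinSup.IsHom.id {T : TNorm} (A : MonFinSup.{u} T) :
    MonFinSup.IsHom A A (fun x => x) :=
  ⟨IsFinitelyCocontinuous.id T _, rfl, fun _ _ => rfl⟩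

theorem MonFinSup.IsHom.comp {T : TNorm} {A B C : MonFinSup.{u} T} {g : B.carrier → C.carrier}
    {f : A.carrier → B.carrier} (hg : IsHom B C g) (hf : IsHom A B f) :
    IsHom A C (fun x => g (f x)) :=
  ⟨IsFinitelyCocontinuous.comp T hg.1 hf.1, by rw [hf.map_one, hg.map_one],
    fun x y => by rw [hf.map_mul, hg.map_mul]⟩

instance (T : TNorm) : Category.{u} (PowMon.{u} T) where
  Hom A B := PowMon.Hom A B
  id A := ⟨fun x => x, MonFinSup.IsHom.id _, fun _ _ _ h => h⟩
  comp f g := ⟨fun x => g.toFun (f.toFun x), g.isHom.comp f.isHom,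
    fun x u p h => g.map_power _ _ _ (f.map_power x u p h)⟩

instance (T : TNorm) : Category.{u} (PowMonMinus.{u} T) where
  Hom A B := PowMonMinus.Hom A B
  id A := ⟨fun x => x, MonFinSup.IsHom.id _, fun _ _ => rfl, fun _ _ _ h => h⟩
  comp f g := ⟨fun x => g.toFun (f.toFun x), g.isHom.comp f.isHom,
    fun x u => by rw [f.map_ominus, g.map_ominus],
    fun x u p h => g.map_power _ _ _ (f.map_power x u p h)⟩

/-- The category `𝖠` for the Łukasiewicz tensor. -/
abbrev ALukasiewicz := PowMon.{u} TNorm.lukasiewicz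

/-- The category `𝖠` for multiplication. -/
abbrev AMultiplication := PowMonMinus.{u} TNorm.multiplication

/-! ### The function object `C X` of a partially ordered compact space `X`

Partially ordered compact spaces are given by
`[TopologicalSpace X] [CompactSpace X] [PartialOrder X] [OrderClosedTopology X]`. -/

/-- The set `PosComp(X, [0,1]ᵒᵖ)`: the monotone continuous maps `X → [0,1]ᵒᵖ` are the antitone
continuous maps `X → [0,1]`. -/
def CFun (X : Type u) [TopologicalSpace X] [PartialOrder X] : Type u :=
  {ψ : X → 𝕀 // Antitone ψ ∧ Continuous ψ}

namespace CFun

variable {X : Type u} [TopologicalSpace X] [PartialOrder X]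

instance : CoeFun (CFun X) (fun _ => X → 𝕀) := ⟨fun ψ => ψ.1⟩

theorem ext {ψ φ : CFun X} (h : ∀ x, ψ x = φ x) : ψ = φ := Subtype.ext (funext h)

variable (T : TNorm)

noncomputable instance : VCategory T (CFun X) where
  d ψ φ := ⨅ x, T.hom (ψ x) (φ x)
  one_le_d ψ := le_iInf fun x => T.le_hom_iff.2 (T.tensor_one _).le
  d_tensor_d_le ψ φ χ := le_iInf fun x => T.le_hom_iff.2 <| by
    rw [← T.tensor_assoc]
    refine le_trans (T.tensor_mono ?_ le_rfl) (T.le_hom_iff.1 (iInf_le _ x))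
    exact T.le_hom_iff.1 (iInf_le _ x)

theorem le_d_iff {ψ φ : CFun X} {w : 𝕀} :
    w ≤ VCategory.d T ψ φ ↔ ∀ x, T.tensor (ψ x) w ≤ φ x := by
  change w ≤ ⨅ x, T.hom (ψ x) (φ x) ↔ _
  simp only [le_iInf_iff, T.le_hom_iff]

theorem isSeparated : IsSeparated T (CFun X) := by
  intro ψ φ h h'
  rw [le_d_iff] at h h'
  refine ext fun x => le_antisymm ?_ ?_
  · simpa only [T.tensor_one] using h x
  · simpa only [T.tensor_one] using h' x

theorem isWeightedColimit_of_eq {D : Type*} {h : D → CFun X} {ψ : D → Unit → 𝕀} {χ : CFun X}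
    (hχ : ∀ x, χ x = ⨆ z, T.tensor (h z x) (ψ z ())) : IsWeightedColimit T h ψ χ := by
  intro φ
  refine eq_of_forall_le_iff fun w => ?_
  simp only [le_iInf_iff, le_d_iff, T.le_hom_iff, hχ, T.iSup_tensor, iSup_le_iff, T.tensor_assoc]
  exact forall_comm

/-- The pointwise colimit of a finite diagram. -/
noncomputable def colim {D : Type*} [Finite D] (h : D → CFun X) (ψ : D → Unit → 𝕀) : CFun X :=
  ⟨fun x => ⨆ z, T.tensor (h z x) (ψ z ()),
    fun x y hxy => iSup_mono fun z => T.tensor_mono ((h z).2.1 hxy) le_rfl, by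
      have := Fintype.ofFinite D
      simp only [← Finset.sup_univ_eq_iSup]
      refine Continuous.finset_sup_apply (s := Finset.univ) fun z _ => ?_
      exact T.continuous_tensor.comp ((h z).2.2.prodMk continuous_const)⟩

theorem isFinitelyCocomplete : IsFinitelyCocomplete T (CFun X) := fun _ _ _ h ψ _ _ =>
  ⟨colim T h ψ, isWeightedColimit_of_eq T fun _ => rfl⟩

theorem eq_of_isWeightedColimit {D : Type*} [Finite D] {h : D → CFun X} {ψ : D → Unit → 𝕀}
    {χ : CFun X} (hχ : IsWeightedColimit T h ψ χ) (x : X) :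
    χ x = ⨆ z, T.tensor (h z x) (ψ z ()) := by
  have h' : IsWeightedColimit T h ψ (colim T h ψ) := isWeightedColimit_of_eq T fun _ => rfl
  have : χ = colim T h ψ := by
    apply isSeparated T
    · rw [hχ, ← h']; exact VCategory.one_le_d _
    · rw [h', ← hχ]; exact VCategory.one_le_d _
  rw [this]; rfl

/-- Pointwise tensor. -/
def mul (ψ φ : CFun X) : CFun X :=
  ⟨fun x => T.tensor (ψ x) (φ x), fun _ _ h => T.tensor_mono (ψ.2.1 h) (φ.2.1 h),
    T.continuous_tensor.comp (ψ.2.2.prodMk φ.2.2)⟩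

/-- The constant function `1`. -/
def one : CFun X := ⟨fun _ => 1, fun _ _ _ => le_rfl, continuous_const⟩

theorem isFinitelyCocontinuous_mul (ψ : CFun X) : IsFinitelyCocontinuous T (mul T ψ) := by
  refine ⟨fun φ χ => ?_, fun D _ _ h w _ _ χ hχ => isWeightedColimit_of_eq T fun x => ?_⟩
  · rw [le_d_iff]
    intro x
    simp only [mul, T.tensor_assoc]
    exact T.tensor_mono_right _ ((le_d_iff T).1 le_rfl x)
  · simp only [mul, Function.comp, eq_of_isWeightedColimit T hχ x, T.tensor_comm (ψ x),
      T.iSup_tensor]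
    refine iSup_congr fun z => ?_
    rw [T.tensor_assoc, T.tensor_assoc, T.tensor_comm (w z ())]

/-- Pointwise powers. -/
noncomputable def power (hT : ∀ u, Continuous (T.hom u)) (ψ : CFun X) (u : 𝕀) : CFun X :=
  ⟨fun x => T.hom u (ψ x), fun _ _ h => T.hom_mono_right u (ψ.2.1 h), (hT u).comp ψ.2.2⟩

theorem isPower (hT : ∀ u, Continuous (T.hom u)) (ψ : CFun X) (u : 𝕀) :
    IsPower T ψ u (power T hT ψ u) := by
  intro φ
  refine eq_of_forall_le_iff fun w => ?_
  rw [T.le_hom_iff, le_d_iff, le_d_iff]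
  simp only [power, T.le_hom_iff]
  refine forall_congr' fun x => ?_
  rw [← T.tensor_assoc, ← T.tensor_assoc, T.tensor_comm u]

/-- Pointwise truncated minus. -/
noncomputable def ominus (ψ : CFun X) (u : 𝕀) : CFun X :=
  ⟨fun x => truncSub (ψ x) u, fun x y h => by
      have h' : ((ψ y : 𝕀) : ℝ) ≤ ψ x := ψ.2.1 h
      exact Subtype.mk_le_mk.2 (max_le_max le_rfl (by linarith)), by
      have := ψ.2.2
      unfold truncSub
      fun_prop⟩

variable (X)

/-- `C X` as a commutative monoid in separated finitely cocomplete `[0,1]`-categories, with all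
operations pointwise. -/
noncomputable def monFinSup : MonFinSup.{u} T where
  carrier := CFun X
  separated := isSeparated T
  finitelyCocomplete := isFinitelyCocomplete T
  mul := mul T
  one := one
  mul_assoc _ _ _ := ext fun _ => T.tensor_assoc _ _ _
  mul_comm _ _ := ext fun _ => T.tensor_comm _ _
  mul_one _ := ext fun _ => T.tensor_one _
  le_one _ := (le_d_iff T).2 fun _ => unitInterval.le_one'
  finitelyCocontinuous_mul := isFinitelyCocontinuous_mul T

/-- `C X` as a commutative monoid with pointwise action `⊖`. -/
noncomputable def monFinSupMinus : MonFinSupMinus.{u} T where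
  toMonFinSup := monFinSup X T
  ominus := ominus
  ominus_zero (ψ : CFun X) := ext fun x => Subtype.ext <| by
    simp [ominus, truncSub, (ψ x).2.1]
  ominus_ominus (ψ : CFun X) u v := ext fun x => Subtype.ext <| by
    have h1 := (ψ x).2.2
    have h2 := u.2.1
    have h3 := v.2.1
    simp only [ominus, truncSub, truncAdd]
    grind

/-- `C X` as an object of the category `𝖠` for the Łukasiewicz tensor. -/
noncomputable def lukasiewicz : ALukasiewicz.{u} where
  toMonFinSup := monFinSup X TNorm.lukasiewicz
  powered := fun (ψ : CFun X) u => ⟨_, isPower _ TNorm.continuous_hom_lukasiewicz ψ u⟩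

/-- `C X` as an object of the category `𝖠` for multiplication. -/
noncomputable def multiplication : AMultiplication.{u} where
  toMonFinSupMinus := monFinSupMinus X TNorm.multiplication
  powered := fun (ψ : CFun X) u => ⟨_, isPower _ TNorm.continuous_hom_multiplication ψ u⟩

end CFun

/-! ### Cones into `[0,1]ᵒᵖ` -/

/-- The cone `(F i : X → [0,1]ᵒᵖ)` is point-separating. -/
def IsPointSeparating {X : Type u} [TopologicalSpace X] [PartialOrder X] {ι : Type*}
    (F : ι → CFun X) : Prop :=
  ∀ x y, (∀ i, F i x = F i y) → x = y

/-- The cone `(F i : X → [0,1]ᵒᵖ)` in the category of partially ordered compact spaces is initial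
with respect to the forgetful functor to sets: a map `f : Y → X` from a partially ordered compact
space is a morphism as soon as all composites with the `F i` are morphisms `Y → [0,1]ᵒᵖ`. -/
def IsInitialCone {X : Type u} [TopologicalSpace X] [PartialOrder X] {ι : Type*}
    (F : ι → CFun X) : Prop :=
  ∀ (Y : Type u) [TopologicalSpace Y] [CompactSpace Y] [PartialOrder Y] [OrderClosedTopology Y]
    (f : Y → X), (∀ i, Antitone (F i ∘ f) ∧ Continuous (F i ∘ f)) → Monotone f ∧ Continuous f

/-! An injective finitely cocontinuous functor is fully faithful (`IsFinitelyCocontinuous.d_eq`), so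
the inverse of a bijective `m` is again a morphism: `m` is an isomorphism exactly when it is
surjective. Since `CX` is Cauchy-complete (`CFun.isCauchyComplete`), an isomorphic `A` is too.

Conversely, let `A` be Cauchy-complete. Its image is closed for the symmetrised structure
(`IsCauchyComplete.mem_range`), so density is what remains. The image is closed under tensor,
weighted binary suprema and `hom u`, and its members detect the order of `X`
(`CFun.exists_lt_of_isInitialCone`). Powers together with iterated tensors (Łukasiewicz) or with `⊖`
(multiplication) sharpen a strict inequality to functions that are locally `0` and locally `1`.
Compactness then gives Urysohn functions, and weighted suprema of these give staircase
approximations (`CFun.IsTensorClosed.exists_abs_sub_le`).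

For Łukasiewicz, uniform closeness is closeness in `d`. For multiplication `d` measures quotients,
so the argument is run for `1/4 + ψ/2`, from which `ψ` is recovered by `⊖` and a power. -/

open Filter Topology

open VCategory (d one_le_d d_tensor_d_le)

/-! ### Tensor and internal hom -/

namespace TNorm

variable (T : TNorm)

theorem one_tensor (u : 𝕀) : T.tensor 1 u = u := by
  rw [T.tensor_comm, T.tensor_one]

theorem tensor_le_right (u v : 𝕀) : T.tensor u v ≤ v :=
  (T.tensor_mono unitInterval.le_one' le_rfl).trans (T.one_tensor v).le

theorem tensor_le_left (u v : 𝕀) : T.tensor u v ≤ u :=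
  (T.tensor_comm u v).le.trans (T.tensor_le_right v u)

theorem tensor_zero (u : 𝕀) : T.tensor u 0 = 0 :=
  le_antisymm (T.tensor_le_right u 0) unitInterval.nonneg'

theorem zero_tensor (u : 𝕀) : T.tensor 0 u = 0 :=
  le_antisymm (T.tensor_le_left 0 u) unitInterval.nonneg'

theorem one_hom (u : 𝕀) : T.hom 1 u = u :=
  eq_of_forall_le_iff fun w => by rw [T.le_hom_iff, T.one_tensor]

theorem one_le_hom_iff {u v : 𝕀} : 1 ≤ T.hom u v ↔ u ≤ v := by
  rw [T.le_hom_iff, T.tensor_one]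

theorem hom_eq_one {u v : 𝕀} (h : u ≤ v) : T.hom u v = 1 :=
  le_antisymm unitInterval.le_one' (T.one_le_hom_iff.2 h)

/-- A number that dominates the squares of all `w < 1` is `1`. -/
theorem one_le_of_forall_tensor_self_le {s : 𝕀} (h : ∀ w < 1, T.tensor w w ≤ s) : 1 ≤ s := by
  have hc : Continuous fun w : 𝕀 => T.tensor w w :=
    T.continuous_tensor.comp (continuous_id.prodMk continuous_id)
  -- As `1` is not isolated from the left, one may let `w` tend to `1`, where `w ⊗ w` tends to `1 ⊗
  -- 1 = 1`.
  have hne : (𝓝[<] (1 : 𝕀)).NeBot := nhdsLT_neBot_of_exists_lt ⟨0, zero_lt_one⟩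
  have ht : Tendsto (fun w : 𝕀 => T.tensor w w) (𝓝[<] 1) (𝓝 1) := by
    have := hc.tendsto 1
    rw [T.tensor_one] at this
    exact this.mono_left nhdsWithin_le_nhds
  exact le_of_tendsto ht (eventually_mem_nhdsWithin.mono h)

/-- Uniform continuity of the tensor on the compact square, comparing `(v, u)` with `(v, 1)`, makes
`w` independent of `v`. -/
theorem exists_dist_tensor_lt {ε : ℝ} (hε : 0 < ε) :
    ∃ w < (1 : 𝕀), ∀ u v, w ≤ u → dist (T.tensor v u) v < ε := by
  have hu := CompactSpace.uniformContinuous_of_continuous T.continuous_tensor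
  obtain ⟨δ, hδ, h⟩ := Metric.uniformContinuous_iff.1 hu ε hε
  have hlt : max 0 (1 - δ / 2) < 1 := max_lt zero_lt_one (by linarith)
  refine ⟨⟨max 0 (1 - δ / 2), le_max_left _ _, hlt.le⟩, hlt, fun u v hwu => ?_⟩
  have h' := @h (v, u) (v, 1) ?_
  · simpa only [T.tensor_one] using h'
  · have h1 : 1 - δ / 2 ≤ (u : ℝ) := (le_max_right _ _).trans hwu
    have h2 := u.2.2
    rw [Prod.dist_eq, dist_self, max_lt_iff, Subtype.dist_eq, Real.dist_eq, abs_lt]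
    refine ⟨hδ, ?_, ?_⟩ <;> simp only [Set.Icc.coe_one] <;> linarith

end TNorm

/-! ### Categories enriched in the quantale -/

section VCategory

variable {T : TNorm} {X Y : Type u} [VCategory T X] [VCategory T Y]

theorem VCategory.d_self (x : X) : d T x x = 1 :=
  le_antisymm unitInterval.le_one' (one_le_d x)

theorem IsSeparated.eq_of_isPower (hX : IsSeparated T X) {x p q : X} {u : 𝕀}
    (hp : IsPower T x u p) (hq : IsPower T x u q) : p = q := by
  apply hX
  · rw [← hq, hp]; exact one_le_d _
  · rw [← hp, hq]; exact one_le_d _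

/-- The discrete `[0,1]`-category on two points. -/
noncomputable abbrev VCategory.discreteBool (T : TNorm) : VCategory T (ULift.{u} Bool) where
  d x y := if x = y then 1 else 0
  one_le_d x := by simp
  d_tensor_d_le x y z := by
    split_ifs with h1 h2 h3 <;> simp_all [T.tensor_zero, T.zero_tensor, T.tensor_one]

theorem iInf_uLift_bool (f : ULift.{u} Bool → 𝕀) : ⨅ z, f z = f ⟨true⟩ ⊓ f ⟨false⟩ := by
  rw [← Equiv.ulift.symm.iInf_comp, iInf_bool_eq]; rfl

theorem iSup_uLift_bool (f : ULift.{u} Bool → 𝕀) : ⨆ z, f z = f ⟨true⟩ ⊔ f ⟨false⟩ := by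
  rw [← Equiv.ulift.symm.iSup_comp, iSup_bool_eq]; rfl

/-- Existence of weighted binary suprema, together with their preservation by finitely
cocontinuous functors. -/
theorem IsFinitelyCocomplete.exists_binary (hX : IsFinitelyCocomplete T X) (x y : X) (u v : 𝕀) :
    ∃ c : X, ∃ _ : VCategory T (ULift.{u} Bool), ∃ ψ : ULift.{u} Bool → Unit → 𝕀,
      ψ ⟨true⟩ () = u ∧ ψ ⟨false⟩ () = v ∧
      IsWeightedColimit T (fun z : ULift.{u} Bool => cond z.down x y) ψ c ∧
      ∀ {Y : Type u} [VCategory T Y] {f : X → Y}, IsFinitelyCocontinuous T f →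
        IsWeightedColimit T (fun z : ULift.{u} Bool => f (cond z.down x y)) ψ (f c) := by
  -- On a discrete index any pair of points is a functor and any pair of weights a distributor.
  let _ : VCategory T (ULift.{u} Bool) := VCategory.discreteBool T
  have hd : ∀ z w : ULift.{u} Bool, z ≠ w → d T z w = 0 := fun _ _ h => if_neg h
  have hh : IsVFunctor T fun z : ULift.{u} Bool => cond z.down x y := by
    intro z w
    by_cases h : z = w
    · subst h
      exact unitInterval.le_one'.trans (one_le_d _)
    · exact (hd z w h).trans_le unitInterval.nonneg'
  have hψ : IsDistributor T fun (z : ULift.{u} Bool) (_ : Unit) => cond z.down u v := by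
    refine ⟨fun z _ => iSup_le fun w => ?_, fun z _ => iSup_le fun w => ?_⟩
    · by_cases h : z = w
      · subst h
        exact T.tensor_le_right _ _
      · rw [hd z w h, T.zero_tensor]
        exact unitInterval.nonneg'
    · exact T.tensor_le_left _ _
  obtain ⟨c, hc⟩ := hX _ _ _ hh hψ
  exact ⟨c, inferInstance, fun z _ => cond z.down u v, rfl, rfl, hc,
    fun hf => hf.2 _ _ _ hh hψ c hc⟩

/-- An injective finitely cocontinuous functor is fully faithful. -/
theorem IsFinitelyCocontinuous.d_eq (hX : IsFinitelyCocomplete T X) (hY : IsSeparated T Y)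
    {f : X → Y} (hf : IsFinitelyCocontinuous T f) (hinj : Function.Injective f) (x y : X) :
    d T (f x) (f y) = d T x y := by
  refine le_antisymm ?_ (hf.1 x y)
  -- Let `c` be the supremum of `y` and `x` weighted by `d (f x) (f y)`. Its image is `f y`, because
  -- the weighted `f x` already lies below `f y`. Hence `c = y`, and the colimit property of `c`
  -- bounds `d x y` from below.
  obtain ⟨c, _, ψ, h1, h2, hc, hfc⟩ := hX.exists_binary x y (d T (f x) (f y)) 1
  have hfc := hfc hf
  simp only [IsWeightedColimit, iInf_uLift_bool, h1, h2, cond_true, cond_false, T.one_hom]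
    at hc hfc
  have hcy : c = y := by
    apply hinj
    apply hY
    · rw [hfc, VCategory.d_self, le_inf_iff]
      exact ⟨T.one_le_hom_iff.2 le_rfl, le_rfl⟩
    · exact (one_le_d (f c)).trans ((hfc _).le.trans inf_le_right)
  subst hcy
  exact T.one_le_hom_iff.1 ((one_le_d c).trans ((hc c).le.trans inf_le_left))

theorem IsFinitelyCocontinuous.symm {e : X ≃ Y} (he : ∀ x y, d T (e x) (e y) = d T x y) :
    IsFinitelyCocontinuous T e.symm := by
  refine ⟨fun x y => ?_, fun D _ _ h ψ _ _ x₀ hx₀ x => ?_⟩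
  · rw [← he, e.apply_symm_apply, e.apply_symm_apply]
  · simp only [← he, Function.comp, e.apply_symm_apply, hx₀ (e x)]

theorem IsPower.symm {e : X ≃ Y} (he : ∀ x y, d T (e x) (e y) = d T x y) {y p : Y} {u : 𝕀}
    (hp : IsPower T y u p) : IsPower T (e.symm y) u (e.symm p) := by
  intro x
  simp only [← he, e.apply_symm_apply, hp (e x)]

theorem IsCauchyComplete.of_equiv {e : X ≃ Y} (he : ∀ x y, d T (e x) (e y) = d T x y)
    (hY : IsCauchyComplete T Y) : IsCauchyComplete T X := by
  intro D _ h ψ hh hψ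
  obtain ⟨y, hy⟩ := hY D (e ∘ h) ψ (fun z w => (hh z w).trans (he _ _).ge) hψ
  refine ⟨e.symm y, fun x => ?_⟩
  simp only [← he, e.apply_symm_apply, hy (e x), Function.comp]

/-- The image of a Cauchy-complete category under a fully faithful functor is closed. -/
theorem IsCauchyComplete.mem_range (hX : IsCauchyComplete T X) (hY : IsSeparated T Y) {f : X → Y}
    (hf : ∀ x y, d T (f x) (f y) = d T x y) {y : Y}
    (hy : ∀ w < 1, ∃ x, w ≤ d T y (f x) ∧ w ≤ d T (f x) y) : ∃ x, f x = y := by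
  have hsup : (1 : 𝕀) ≤ ⨆ x, T.tensor (d T y (f x)) (d T (f x) y) := by
    refine T.one_le_of_forall_tensor_self_le fun w hw => ?_
    obtain ⟨x, h1, h2⟩ := hy w hw
    exact le_iSup_of_le x (T.tensor_mono h1 h2)
  -- The left adjoint is `d y (f -)`; `hsup` is the unit inequality of the adjunction.
  have hψ : IsRightAdjointDistributor T fun (x : X) (_ : Unit) => d T (f x) y := by
    refine ⟨⟨fun x _ => iSup_le fun x' => ?_, fun x _ => iSup_le fun _ => ?_⟩,
      fun _ x => d T y (f x), ⟨fun _ x => iSup_le fun _ => ?_, fun _ x => iSup_le fun x' => ?_⟩,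
      fun _ _ => ?_, fun x x' => iSup_le fun _ => ?_⟩
    · rw [← hf]; exact d_tensor_d_le _ _ _
    · exact T.tensor_le_left _ _
    · exact T.tensor_le_right _ _
    · rw [← hf]; exact d_tensor_d_le _ _ _
    · exact unitInterval.le_one'.trans hsup
    · rw [← hf]; exact d_tensor_d_le _ _ _
  obtain ⟨x₀, hx₀⟩ := hX X (fun x => x) _ (fun _ _ => le_rfl) hψ
  have key : ∀ x, d T (f x₀) (f x) = d T y (f x) := by
    intro x
    rw [hf, hx₀ x]
    refine eq_of_forall_le_iff fun w => ?_
    simp only [le_iInf_iff, T.le_hom_iff]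
    constructor
    · intro h
      -- Write `1` as the supremum of `d y (f x') ⊗ d (f x') y` and compose through each `f x'`.
      have := T.tensor_mono hsup (le_refl w)
      rw [T.one_tensor, T.iSup_tensor] at this
      refine this.trans (iSup_le fun x' => ?_)
      rw [T.tensor_assoc]
      refine (T.tensor_mono_right _ (h x')).trans ?_
      rw [← hf]
      exact d_tensor_d_le _ _ _
    · intro h x'
      rw [← hf]
      exact (T.tensor_mono_right _ h).trans (d_tensor_d_le _ _ _)
  refine ⟨x₀, hY _ _ ?_ ?_⟩
  · refine hsup.trans (iSup_le fun x => ?_)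
    rw [← key]
    exact d_tensor_d_le _ _ _
  · rw [← key]
    exact one_le_d _

end VCategory

/-! ### Isomorphisms of structured categories -/

theorem MonFinSup.IsHom.symm {T : TNorm} {A B : MonFinSup.{u} T} {e : A.carrier ≃ B.carrier}
    (h : MonFinSup.IsHom A B e) (he : ∀ x y, d T (e x) (e y) = d T x y) :
    MonFinSup.IsHom B A e.symm where
  finitelyCocontinuous := IsFinitelyCocontinuous.symm he
  map_one := by rw [e.symm_apply_eq, h.map_one]
  map_mul x y := by simp [e.symm_apply_eq, h.map_mul]

theorem MonFinSup.IsHom.d_eq {T : TNorm} {A B : MonFinSup.{u} T} {f : A.carrier → B.carrier}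
    (h : MonFinSup.IsHom A B f) (hf : Function.Injective f) (x y : A.carrier) :
    d T (f x) (f y) = d T x y :=
  h.finitelyCocontinuous.d_eq A.finitelyCocomplete B.separated hf x y

/-- Colimits and powers are defined through `d` alone, so a bijection preserving `d` has an inverse
preserving them. -/
theorem PowMon.isIso_iff_surjective {T : TNorm} {A B : PowMon.{u} T} (m : A ⟶ B)
    (hm : Function.Injective m.toFun) : IsIso m ↔ Function.Surjective m.toFun := by
  constructor
  · intro _ b
    exact ⟨(inv m).toFun b, congrFun (congrArg PowMon.Hom.toFun (IsIso.inv_hom_id m)) b⟩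
  · intro hs
    let e : A.carrier ≃ B.carrier := Equiv.ofBijective m.toFun ⟨hm, hs⟩
    have he : ∀ x y, d T (e x) (e y) = d T x y := m.isHom.d_eq hm
    have hh : MonFinSup.IsHom A.toMonFinSup B.toMonFinSup e := m.isHom
    exact ⟨⟨e.symm, hh.symm he, fun _ _ _ h => h.symm he⟩,
      PowMon.Hom.ext (funext e.symm_apply_apply), PowMon.Hom.ext (funext e.apply_symm_apply)⟩

theorem PowMonMinus.isIso_iff_surjective {T : TNorm} {A B : PowMonMinus.{u} T} (m : A ⟶ B)
    (hm : Function.Injective m.toFun) : IsIso m ↔ Function.Surjective m.toFun := by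
  constructor
  · intro _ b
    exact ⟨(inv m).toFun b, congrFun (congrArg PowMonMinus.Hom.toFun (IsIso.inv_hom_id m)) b⟩
  · intro hs
    let e : A.carrier ≃ B.carrier := Equiv.ofBijective m.toFun ⟨hm, hs⟩
    have he : ∀ x y, d T (e x) (e y) = d T x y := m.isHom.d_eq hm
    have hh : MonFinSup.IsHom A.toMonFinSup B.toMonFinSup e := m.isHom
    have ho : ∀ x u, e (A.ominus x u) = B.ominus (e x) u := m.map_ominus
    exact ⟨⟨e.symm, hh.symm he, fun x u => by rw [e.symm_apply_eq, ho, e.apply_symm_apply],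
        fun _ _ _ h => h.symm he⟩,
      PowMonMinus.Hom.ext (funext e.symm_apply_apply),
      PowMonMinus.Hom.ext (funext e.apply_symm_apply)⟩

/-! ### The function object is Cauchy-complete -/

namespace CFun

variable {X : Type u} [TopologicalSpace X] [PartialOrder X]

/-- The colimit must be the pointwise supremum `χ`; only its continuity is at stake. A single index
`z` with `φ z ⊗ ψ z` near `1` yields a term uniformly close to `χ`, so `χ` is a uniform limit of
continuous functions. -/
theorem isCauchyComplete (T : TNorm) : IsCauchyComplete T (CFun X) := by
  intro D _ h ψ hh hψ
  obtain ⟨-, φ, -, hone, hle⟩ := hψ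
  let χ : X → 𝕀 := fun x => ⨆ z, T.tensor (h z x) (ψ z ())
  have hχ : ∀ x z, T.tensor (χ x) (φ () z) ≤ h z x := by
    intro x z
    rw [T.iSup_tensor]
    refine iSup_le fun z' => ?_
    rw [T.tensor_assoc]
    refine (T.tensor_mono_right _ ?_).trans ((le_d_iff T).1 (hh z' z) x)
    exact (le_iSup (fun y : Unit => T.tensor (ψ z' y) (φ y z)) ()).trans (hle z' z)
  have hcont : Continuous χ := by
    refine continuous_of_uniform_approx_of_continuous fun U hU => ?_
    obtain ⟨ε, hε, hU⟩ := Metric.mem_uniformity_dist.1 hU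
    obtain ⟨w, hw, hT⟩ := T.exists_dist_tensor_lt hε
    obtain ⟨z, hz⟩ := lt_iSup_iff.1 (hw.trans_le (hone () ()))
    refine ⟨fun x => T.tensor (h z x) (ψ z ()),
      T.continuous_tensor.comp ((h z).2.2.prodMk continuous_const), fun x => hU ?_⟩
    have h1 : T.tensor (h z x) (ψ z ()) ≤ χ x := le_iSup (fun z => T.tensor (h z x) (ψ z ())) z
    -- The term at `z` is squeezed between `χ x ⊗ (φ z ⊗ ψ z)`, which is within `ε` of `χ x`, and `χ
    -- x` itself.
    have h2 : T.tensor (χ x) (T.tensor (φ () z) (ψ z ())) ≤ T.tensor (h z x) (ψ z ()) := by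
      rw [← T.tensor_assoc]
      exact T.tensor_mono (hχ x z) le_rfl
    have h3 := hT _ (χ x) hz.le
    rw [Subtype.dist_eq, Real.dist_eq, abs_lt] at h3 ⊢
    rw [← Subtype.coe_le_coe] at h1 h2
    constructor <;> linarith
  exact ⟨⟨χ, fun x y hxy => iSup_mono fun z => T.tensor_mono ((h z).2.1 hxy) le_rfl, hcont⟩,
    isWeightedColimit_of_eq T fun _ => rfl⟩

/-! ### A Stone–Weierstrass theorem -/

/-- A set of functions is closed under the operations of a powered commutative monoid in
finitely cocomplete `[0,1]`-categories. -/
structure IsTensorClosed (T : TNorm) (L : Set (CFun X)) : Prop where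
  one_mem : one ∈ L
  mul_mem : ∀ f ∈ L, ∀ g ∈ L, mul T f g ∈ L
  sup_mem : ∀ f ∈ L, ∀ g ∈ L, ∀ u v : 𝕀,
    ∃ k ∈ L, ∀ x, k x = T.tensor (f x) u ⊔ T.tensor (g x) v
  hom_mem : ∀ f ∈ L, ∀ u : 𝕀, ∃ k ∈ L, ∀ x, k x = T.hom u (f x)

/-- Points not related by the order have neighbourhoods on which some member of `L` is constant
`0` and `1`, respectively. -/
def LocallySeparates (L : Set (CFun X)) : Prop :=
  ∀ x y : X, ¬ x ≤ y → ∃ f ∈ L, (∀ᶠ z in 𝓝 x, f z = 0) ∧ ∀ᶠ z in 𝓝 y, f z = 1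

/-- Colimits and powers in `CX` are unique by separatedness, so `m` must send those of `A` to the
pointwise formulas. -/
theorem isTensorClosed_range {T : TNorm} (hT : ∀ u, Continuous (T.hom u)) {A : MonFinSup.{u} T}
    (hA : IsPowered T A.carrier) {m : A.carrier → CFun X}
    (hm : MonFinSup.IsHom A (monFinSup X T) m)
    (hp : ∀ a u p, IsPower T a u p → IsPower T (m a) u (m p)) :
    IsTensorClosed T (Set.range m) where
  one_mem := ⟨A.one, hm.map_one⟩
  mul_mem := by
    rintro _ ⟨a, rfl⟩ _ ⟨b, rfl⟩
    exact ⟨A.mul a b, hm.map_mul a b⟩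
  sup_mem := by
    rintro _ ⟨a, rfl⟩ _ ⟨b, rfl⟩ u v
    obtain ⟨c, _, ψ, h1, h2, -, hc⟩ := A.finitelyCocomplete.exists_binary a b u v
    have hf : IsFinitelyCocontinuous T m := hm.finitelyCocontinuous
    refine ⟨m c, ⟨c, rfl⟩, fun x => ?_⟩
    rw [eq_of_isWeightedColimit T (hc hf) x, iSup_uLift_bool, h1, h2]
    rfl
  hom_mem := by
    rintro _ ⟨a, rfl⟩ u
    obtain ⟨p, hap⟩ := hA a u
    refine ⟨m p, ⟨p, rfl⟩, fun x => ?_⟩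
    rw [(isSeparated T).eq_of_isPower (hp a u p hap) (isPower T hT (m a) u)]
    rfl

/-- The order induced by the cone is antisymmetric by point separation and closed by continuity.
Initiality, applied to the identity from `X` with this order, shows that it is contained in the
given order. -/
theorem exists_lt_of_isInitialCone [CompactSpace X] [OrderClosedTopology X] {ι : Type*}
    {F : ι → CFun X} (hs : IsPointSeparating F) (hi : IsInitialCone F) {x y : X} (h : ¬ x ≤ y) :
    ∃ i, F i x < F i y := by
  by_contra! hcon
  let P : PartialOrder X :=
    { le := fun a b => ∀ i, F i b ≤ F i a
      lt := fun a b => (∀ i, F i b ≤ F i a) ∧ ¬ ∀ i, F i a ≤ F i b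
      le_refl := fun _ _ => le_rfl
      le_trans := fun _ _ _ h1 h2 i => (h2 i).trans (h1 i)
      le_antisymm := fun a b h1 h2 => hs a b fun i => le_antisymm (h2 i) (h1 i) }
  have hP : @OrderClosedTopology X _ P.toPreorder := by
    refine @OrderClosedTopology.mk X _ P.toPreorder ?_
    have : {p : X × X | ∀ i, F i p.2 ≤ F i p.1} = ⋂ i, {p : X × X | F i p.2 ≤ F i p.1} := by
      ext; simp
    change IsClosed {p : X × X | ∀ i, F i p.2 ≤ F i p.1}
    rw [this]
    exact isClosed_iInter fun i => isClosed_le ((F i).2.2.comp continuous_snd)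
      ((F i).2.2.comp continuous_fst)
  exact h ((@hi X _ _ P hP id fun i => ⟨fun _ _ hab => hab i, (F i).2.2⟩).1 hcon)

namespace IsTensorClosed

variable {T : TNorm} {L : Set (CFun X)}

theorem exists_zero (hL : IsTensorClosed T L) : ∃ f ∈ L, ∀ x, f x = 0 := by
  obtain ⟨f, hf, h⟩ := hL.sup_mem _ hL.one_mem _ hL.one_mem 0 0
  exact ⟨f, hf, fun x => by rw [h, T.tensor_zero, sup_idem]⟩

theorem exists_sup (hL : IsTensorClosed T L) {f g : CFun X} (hf : f ∈ L) (hg : g ∈ L) :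
    ∃ k ∈ L, ∀ x, k x = f x ⊔ g x := by
  obtain ⟨k, hk, h⟩ := hL.sup_mem f hf g hg 1 1
  exact ⟨k, hk, fun x => by rw [h, T.tensor_one, T.tensor_one]⟩

/-- Two compact sets separated by the order are separated by a member of `L`. -/
theorem exists_eq_zero_eq_one (hL : IsTensorClosed T L) (hs : LocallySeparates L)
    {F K : Set X} (hF : IsCompact F) (hK : IsCompact K) (h : ∀ x ∈ F, ∀ y ∈ K, ¬ x ≤ y) :
    ∃ f ∈ L, (∀ x ∈ F, f x = 0) ∧ ∀ y ∈ K, f y = 1 := by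
  -- Suprema patch over `K`. For a fixed `y`, tensors patch over `F`: `0` is absorbing, while `1 ⊗ 1
  -- = 1` keeps the value `1` near `y`.
  refine hK.induction_on (p := fun s => ∃ f ∈ L, (∀ x ∈ F, f x = 0) ∧ ∀ y ∈ s, f y = 1)
    ?_ ?_ ?_ ?_
  · obtain ⟨f, hf, h0⟩ := hL.exists_zero
    exact ⟨f, hf, fun x _ => h0 x, by simp⟩
  · rintro s t hst ⟨f, hf, h0, h1⟩
    exact ⟨f, hf, h0, fun y hy => h1 y (hst hy)⟩
  · rintro s t ⟨f, hf, hf0, hf1⟩ ⟨g, hg, hg0, hg1⟩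
    obtain ⟨k, hk, hkx⟩ := hL.exists_sup hf hg
    refine ⟨k, hk, fun x hx => by rw [hkx, hf0 x hx, hg0 x hx, sup_idem], ?_⟩
    rintro y (hy | hy)
    · rw [hkx, hf1 y hy]; exact sup_eq_left.2 unitInterval.le_one'
    · rw [hkx, hg1 y hy]; exact sup_eq_right.2 unitInterval.le_one'
  · intro y hy
    obtain ⟨f, hf, h0, h1⟩ : ∃ f ∈ L, (∀ x ∈ F, f x = 0) ∧ ∀ᶠ z in 𝓝 y, f z = 1 := by
      refine hF.induction_on
        (p := fun s => ∃ f ∈ L, (∀ x ∈ s, f x = 0) ∧ ∀ᶠ z in 𝓝 y, f z = 1) ?_ ?_ ?_ ?_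
      · exact ⟨_, hL.one_mem, by simp, Eventually.of_forall fun _ => rfl⟩
      · rintro s t hst ⟨f, hf, h0, h1⟩
        exact ⟨f, hf, fun x hx => h0 x (hst hx), h1⟩
      · rintro s t ⟨f, hf, hf0, hf1⟩ ⟨g, hg, hg0, hg1⟩
        refine ⟨_, hL.mul_mem f hf g hg, ?_, ?_⟩
        · rintro x (hx | hx)
          · simp only [mul, hf0 x hx, T.zero_tensor]
          · simp only [mul, hg0 x hx, T.tensor_zero]
        · filter_upwards [hf1, hg1] with z hz1 hz2
          simp only [mul, hz1, hz2, T.tensor_one]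
      · intro x hx
        obtain ⟨f, hf, h0, h1⟩ := hs x y (h x hx y hy)
        exact ⟨_, mem_nhdsWithin_of_mem_nhds h0, f, hf, fun _ hz => hz, h1⟩
    exact ⟨_, mem_nhdsWithin_of_mem_nhds h1, f, hf, h0, fun _ hz => hz⟩

/-- Functions closed under the operations that locally separate points are uniformly dense. -/
theorem exists_abs_sub_le [CompactSpace X] (hL : IsTensorClosed T L)
    (hs : LocallySeparates L) (ψ : CFun X) {ε : ℝ} (hε : 0 < ε) : ∃ g ∈ L, ∀ x, |(g x : ℝ) - ψ x| ≤ ε := by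
  obtain ⟨n, hn⟩ := exists_nat_one_div_lt hε
  set N : ℝ := (n : ℝ) + 1 with hN
  have hN0 : 0 < N := by positivity
  -- Staircase with steps of height `1 / N`: stage `j + 1` adds the level `(j + 1) / N`, weighting a
  -- function that is `0` where `ψ ≤ j / N` and `1` where `ψ ≥ (j + 1) / N`. The overshoot is
  -- therefore at most one step.
  have key : ∀ j : ℕ, j ≤ n + 1 → ∃ g ∈ L, ∀ x, (g x : ℝ) ≤ ψ x + 1 / N ∧
      ∀ k : ℕ, k ≤ j → (k / N : ℝ) ≤ ψ x → (k / N : ℝ) ≤ g x := by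
    intro j
    induction j with
    | zero =>
      intro _
      obtain ⟨f, hf, h0⟩ := hL.exists_zero
      refine ⟨f, hf, fun x => ⟨?_, fun k hk _ => ?_⟩⟩
      · rw [h0]
        have := (ψ x).2.1
        simp only [Set.Icc.coe_zero]
        positivity
      · obtain rfl : k = 0 := by omega
        simpa using (f x).2.1
    | succ j ih =>
      intro hj
      obtain ⟨g, hg, hgx⟩ := ih (by omega)
      have hψ : Continuous fun x => (ψ x : ℝ) := continuous_subtype_val.comp ψ.2.2
      obtain ⟨f, hf, hf0, hf1⟩ := hL.exists_eq_zero_eq_one hs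
        (F := {x | (ψ x : ℝ) ≤ j / N}) (K := {x | ((j + 1 : ℕ) / N : ℝ) ≤ ψ x})
        (isClosed_le hψ continuous_const).isCompact (isClosed_le continuous_const hψ).isCompact (by
          intro x hx y hy hxy
          have h1 : (ψ y : ℝ) ≤ ψ x := ψ.2.1 hxy
          have h2 : (j / N : ℝ) < (j + 1 : ℕ) / N := by
            gcongr; simp
          simp only [Set.mem_ofPred_eq] at hx hy
          linarith)
      have hw : ((j + 1 : ℕ) / N : ℝ) ∈ unitInterval := by
        refine ⟨by positivity, (div_le_one hN0).2 ?_⟩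
        rw [hN]; exact_mod_cast hj
      obtain ⟨k, hk, hkx⟩ := hL.sup_mem g hg f hf 1 ⟨_, hw⟩
      refine ⟨k, hk, fun x => ⟨?_, fun i hi hix => ?_⟩⟩
      · rw [hkx, T.tensor_one]
        have hsup : ((g x ⊔ T.tensor (f x) ⟨_, hw⟩ : 𝕀) : ℝ)
            = max (g x : ℝ) (T.tensor (f x) ⟨_, hw⟩ : 𝕀) := rfl
        rw [hsup, max_le_iff]
        refine ⟨(hgx x).1, ?_⟩
        by_cases hx : (ψ x : ℝ) ≤ j / N
        · rw [hf0 x hx, T.zero_tensor]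
          have := (ψ x).2.1
          simp only [Set.Icc.coe_zero]
          positivity
        · have h1 : ((T.tensor (f x) ⟨_, hw⟩ : 𝕀) : ℝ) ≤ (j + 1 : ℕ) / N :=
            T.tensor_le_right _ _
          have h2 : ((j + 1 : ℕ) / N : ℝ) = j / N + 1 / N := by push_cast; ring
          linarith
      · rw [hkx, T.tensor_one]
        rcases Nat.le_succ_iff.1 hi with hi | rfl
        · exact ((hgx x).2 i hi hix).trans (le_sup_left (a := g x))
        · rw [hf1 x hix, T.one_tensor]
          exact le_sup_right (a := g x) (b := ⟨_, hw⟩)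
  obtain ⟨g, hg, hgx⟩ := key (n + 1) le_rfl
  refine ⟨g, hg, fun x => abs_le.2 ⟨?_, ?_⟩⟩
  -- The highest level not above `ψ x` has index `⌊ψ x * N⌋₊ ≤ n + 1`, and it misses `ψ x` by less
  -- than one step.
  · have h0 : 0 ≤ (ψ x : ℝ) * N := mul_nonneg (ψ x).2.1 hN0.le
    have h1 := Nat.floor_le h0
    have h2 := Nat.lt_floor_add_one ((ψ x : ℝ) * N)
    have h3 : ⌊(ψ x : ℝ) * N⌋₊ ≤ n + 1 := by
      refine Nat.floor_le_of_le ?_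
      push_cast
      exact mul_le_of_le_one_left hN0.le (ψ x).2.2
    have h4 := (hgx x).2 _ h3 ((div_le_iff₀ hN0).2 h1)
    have h5 : (ψ x : ℝ) < ⌊(ψ x : ℝ) * N⌋₊ / N + 1 / N := by
      rw [← add_div, lt_div_iff₀ hN0]; exact h2
    linarith
  · linarith [(hgx x).1]

end IsTensorClosed

/-! ### The Łukasiewicz tensor -/

theorem coe_tensor_lukasiewicz (u v : 𝕀) :
    (TNorm.lukasiewicz.tensor u v : ℝ) = max 0 ((u : ℝ) + v - 1) := rfl

/-- Each further tensor factor `f` adds `1 - f` to the gap below `1`, until truncation at `0`. -/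
theorem exists_tensor_pow {L : Set (CFun X)} (hL : IsTensorClosed TNorm.lukasiewicz L)
    {f : CFun X} (hf : f ∈ L) (n : ℕ) :
    ∃ k ∈ L, ∀ x, (k x : ℝ) = max 0 (1 - n * (1 - (f x : ℝ))) := by
  induction n with
  | zero => exact ⟨_, hL.one_mem, fun x => by simp [one]⟩
  | succ n ih =>
    obtain ⟨k, hk, hkx⟩ := ih
    refine ⟨_, hL.mul_mem k hk f hf, fun x => ?_⟩
    have h1 := (f x).2.2
    simp only [mul, coe_tensor_lukasiewicz, hkx, Nat.cast_add, Nat.cast_one]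
    rcases max_cases (0 : ℝ) (1 - n * (1 - (f x : ℝ))) with h | h
    · rw [h.1, max_eq_left (by linarith), max_eq_left (by linarith)]
    · rw [h.1]; congr 1; ring

/-- For `f x < v < w < f y`, the power `hom w f` is `1` where `f > w` and below `1 - (w - v)` where
`f < v`. An `n`-fold tensor power with `n * (w - v) ≥ 1` annihilates the latter values and fixes
`1`. -/
theorem locallySeparates_lukasiewicz {L : Set (CFun X)} (hL : IsTensorClosed TNorm.lukasiewicz L)
    (hs : ∀ x y : X, ¬ x ≤ y → ∃ f ∈ L, f x < f y) : LocallySeparates L := by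
  intro x y hxy
  obtain ⟨f, hf, hlt⟩ := hs x y hxy
  obtain ⟨v, hv1, hv2⟩ := exists_between hlt
  obtain ⟨w, hw1, hw2⟩ := exists_between hv2
  obtain ⟨g, hg, hgz⟩ := hL.hom_mem f hf w
  have hvw : (0 : ℝ) < w - v := sub_pos.2 hw1
  obtain ⟨n, hn⟩ := exists_nat_ge (1 / ((w : ℝ) - v))
  rw [div_le_iff₀ hvw] at hn
  obtain ⟨k, hk, hkz⟩ := exists_tensor_pow hL hg n
  refine ⟨k, hk, ?_, ?_⟩
  · filter_upwards [f.2.2.continuousAt.eventually_lt_const hv1] with z hz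
    have hz : (f z : ℝ) < v := hz
    have h1 : ((TNorm.lukasiewicz.tensor w (g z) : 𝕀) : ℝ) ≤ f z := by
      rw [hgz]; exact TNorm.lukasiewicz.le_hom_iff.1 le_rfl
    rw [coe_tensor_lukasiewicz, max_le_iff] at h1
    have h2 : (n : ℝ) * (w - v) ≤ n * (1 - g z) :=
      mul_le_mul_of_nonneg_left (by linarith) n.cast_nonneg
    apply Subtype.ext
    rw [hkz, max_eq_left (by linarith), Set.Icc.coe_zero]
  · filter_upwards [f.2.2.continuousAt.eventually_const_lt hw2] with z hz
    apply Subtype.ext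
    rw [hkz, hgz, TNorm.hom_eq_one _ hz.le]
    simp

/-- This turns a uniform error of `1 - w` into a lower bound `w` for `d`. -/
theorem le_d_lukasiewicz {ψ g : CFun X} {w : 𝕀} (h : ∀ x, (ψ x : ℝ) - g x ≤ 1 - w) :
    w ≤ d TNorm.lukasiewicz ψ g := by
  refine (le_d_iff _).2 fun x => ?_
  rw [← Subtype.coe_le_coe, coe_tensor_lukasiewicz, max_le_iff]
  exact ⟨(g x).2.1, by linarith [h x]⟩

theorem surjective_lukasiewicz [CompactSpace X] {A : Type u} [VCategory TNorm.lukasiewicz A]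
    {m : A → CFun X}
    (hA : IsCauchyComplete TNorm.lukasiewicz A)
    (hm : ∀ a b, d TNorm.lukasiewicz (m a) (m b) = d TNorm.lukasiewicz a b)
    (hL : IsTensorClosed TNorm.lukasiewicz (Set.range m))
    (hs : LocallySeparates (Set.range m)) : Function.Surjective m := by
  intro ψ
  refine hA.mem_range (isSeparated _) hm fun w hw => ?_
  have hw' : (0 : ℝ) < 1 - w := sub_pos.2 hw
  obtain ⟨_, ⟨a, rfl⟩, ha⟩ := hL.exists_abs_sub_le hs ψ hw'
  exact ⟨a, le_d_lukasiewicz fun x => by linarith [(abs_le.1 (ha x)).1],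
    le_d_lukasiewicz fun x => (abs_le.1 (ha x)).2⟩

/-! ### Multiplication -/

theorem coe_tensor_multiplication (u v : 𝕀) :
    (TNorm.multiplication.tensor u v : ℝ) = u * v := rfl

/-- For `f x < v < w < f y`, `f ⊖ v` vanishes where `f < v` and is at least `w - v` where `f > w`.
The power by `w - v` is truncated division, which sends these values to `0` and `1`. -/
theorem locallySeparates_multiplication {L : Set (CFun X)}
    (hL : IsTensorClosed TNorm.multiplication L) (ho : ∀ f ∈ L, ∀ u, ominus f u ∈ L)
    (hs : ∀ x y : X, ¬ x ≤ y → ∃ f ∈ L, f x < f y) : LocallySeparates L := by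
  intro x y hxy
  obtain ⟨f, hf, hlt⟩ := hs x y hxy
  obtain ⟨v, hv1, hv2⟩ := exists_between hlt
  obtain ⟨w, hw1, hw2⟩ := exists_between hv2
  have hvw : (v : ℝ) < w := hw1
  obtain ⟨k, hk, hkz⟩ := hL.hom_mem _ (ho f hf v) (truncSub w v)
  refine ⟨k, hk, ?_, ?_⟩
  · filter_upwards [f.2.2.continuousAt.eventually_lt_const hv1] with z hz
    have hz : (f z : ℝ) < v := hz
    have h1 : ((TNorm.multiplication.tensor (truncSub w v) (k z) : 𝕀) : ℝ)
        ≤ (ominus f v z : 𝕀) := by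
      rw [hkz]; exact TNorm.multiplication.le_hom_iff.1 le_rfl
    simp only [coe_tensor_multiplication, ominus, truncSub] at h1
    rw [max_eq_left (a := (0 : ℝ)) (b := f z - v) (by linarith),
      max_eq_right (a := (0 : ℝ)) (by linarith)] at h1
    refine le_antisymm ?_ unitInterval.nonneg'
    rw [← Subtype.coe_le_coe]
    exact nonpos_of_mul_nonpos_right h1 (sub_pos.2 hvw)
  · filter_upwards [f.2.2.continuousAt.eventually_const_lt hw2] with z hz
    have hz : (w : ℝ) < f z := hz
    rw [hkz, TNorm.hom_eq_one]
    exact Subtype.mk_le_mk.2 (max_le_max le_rfl (by linarith))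

theorem le_d_multiplication {ψ g : CFun X} {w : 𝕀} (h : ∀ x, (ψ x : ℝ) * w ≤ g x) :
    w ≤ d TNorm.multiplication ψ g :=
  (le_d_iff _).2 h

/-- The function `1/4 + ψ/2`. -/
noncomputable def affine (ψ : CFun X) : CFun X :=
  ⟨fun x => ⟨1 / 4 + (ψ x : ℝ) / 2, by linarith [(ψ x).2.1], by linarith [(ψ x).2.2]⟩,
    fun x y h => by
      have h' : ((ψ y : 𝕀) : ℝ) ≤ ψ x := ψ.2.1 h
      exact Subtype.mk_le_mk.2 (by linarith), by
      have := ψ.2.2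
      fun_prop⟩

/-- Uniform approximation controls quotients only away from `0`, hence the detour through `affine
ψ`, whose values lie in `[1/4, 3/4]`. -/
theorem surjective_multiplication [CompactSpace X] {A : Type u}
    [VCategory TNorm.multiplication A] {m : A → CFun X}
    (hA : IsCauchyComplete TNorm.multiplication A)
    (hm : ∀ a b, d TNorm.multiplication (m a) (m b) = d TNorm.multiplication a b)
    (hL : IsTensorClosed TNorm.multiplication (Set.range m))
    (ho : ∀ f ∈ Set.range m, ∀ u, ominus f u ∈ Set.range m)
    (hs : LocallySeparates (Set.range m)) : Function.Surjective m := by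
  intro ψ
  have hmem : affine ψ ∈ Set.range m := by
    refine hA.mem_range (isSeparated _) hm fun w hw => ?_
    have hw' : (0 : ℝ) < 1 - w := sub_pos.2 hw
    have hw0 := w.2.1
    -- An error of at most `1/8` leaves `m a ≥ 1/8`, so `(1 - w) / 8` is at most `1 - w` times
    -- either function.
    obtain ⟨_, ⟨a, rfl⟩, ha⟩ := hL.exists_abs_sub_le hs (affine ψ)
      (ε := (1 - (w : ℝ)) / 8) (by linarith)
    have hψ : ∀ x, (1 / 4 : ℝ) ≤ affine ψ x := fun x => by
      simp only [affine]; linarith [(ψ x).2.1]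
    refine ⟨a, le_d_multiplication fun x => ?_, le_d_multiplication fun x => ?_⟩
    · have h1 := (abs_le.1 (ha x)).1
      have h2 := mul_le_mul_of_nonneg_right (hψ x) hw'.le
      linarith
    · have h1 := abs_le.1 (ha x)
      have h2 : (1 / 8 : ℝ) ≤ m a x := by linarith [hψ x, h1.1]
      have h3 := mul_le_mul_of_nonneg_right h2 hw'.le
      linarith
  -- Undo `affine`: subtracting `1/4` leaves `ψ/2`, and the `1/2`-power doubles it.
  obtain ⟨k, hk, hkx⟩ := hL.hom_mem _ (ho _ hmem ⟨1 / 4, by norm_num, by norm_num⟩)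
    ⟨1 / 2, by norm_num, by norm_num⟩
  have hkψ : k = ψ := by
    refine ext fun x => ?_
    rw [hkx]
    refine eq_of_forall_le_iff fun w => ?_
    rw [TNorm.le_hom_iff, ← Subtype.coe_le_coe, ← Subtype.coe_le_coe, coe_tensor_multiplication]
    simp only [ominus, truncSub, affine]
    rw [max_eq_right (by linarith [(ψ x).2.1])]
    constructor <;> intro h <;> linarith
  rwa [hkψ] at hk

end CFun

/-! ### Isomorphism versus Cauchy completeness, for both tensors -/

theorem mainTheorem4 (X : Type u) [TopologicalSpace X] [CompactSpace X] [PartialOrder X]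
    [OrderClosedTopology X] :
    (∀ (A : ALukasiewicz.{u}) (m : A ⟶ CFun.lukasiewicz X),
      Function.Injective m.toFun →
      IsPointSeparating (fun a : A.carrier => (m.toFun a : CFun X)) →
      IsInitialCone (fun a : A.carrier => (m.toFun a : CFun X)) →
        (IsIso m ↔ IsCauchyComplete TNorm.lukasiewicz A.carrier)) ∧
    (∀ (A : AMultiplication.{u}) (m : A ⟶ CFun.multiplication X),
      Function.Injective m.toFun →
      IsPointSeparating (fun a : A.carrier => (m.toFun a : CFun X)) →
      IsInitialCone (fun a : A.carrier => (m.toFun a : CFun X)) →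
        (IsIso m ↔ IsCauchyComplete TNorm.multiplication A.carrier)) := by
  refine ⟨fun A m hinj hsep hinit => ?_, fun A m hinj hsep hinit => ?_⟩
  · rw [PowMon.isIso_iff_surjective m hinj]
    have hd := m.isHom.d_eq hinj
    constructor
    · intro hsurj
      exact IsCauchyComplete.of_equiv (e := Equiv.ofBijective m.toFun ⟨hinj, hsurj⟩) hd
        (CFun.isCauchyComplete TNorm.lukasiewicz)
    · intro hA
      have hL := CFun.isTensorClosed_range TNorm.continuous_hom_lukasiewicz A.powered m.isHom
        m.map_power
      refine CFun.surjective_lukasiewicz hA hd hL (CFun.locallySeparates_lukasiewicz hL ?_)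
      intro x y hxy
      obtain ⟨a, ha⟩ := CFun.exists_lt_of_isInitialCone hsep hinit hxy
      exact ⟨_, ⟨a, rfl⟩, ha⟩
  · rw [PowMonMinus.isIso_iff_surjective m hinj]
    have hd := m.isHom.d_eq hinj
    constructor
    · intro hsurj
      exact IsCauchyComplete.of_equiv (e := Equiv.ofBijective m.toFun ⟨hinj, hsurj⟩) hd
        (CFun.isCauchyComplete TNorm.multiplication)
    · intro hA
      have hL := CFun.isTensorClosed_range TNorm.continuous_hom_multiplication A.powered m.isHom
        m.map_power
      have ho : ∀ f ∈ Set.range (m.toFun : A.carrier → CFun X), ∀ u,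
          CFun.ominus f u ∈ Set.range (m.toFun : A.carrier → CFun X) := by
        rintro _ ⟨a, rfl⟩ u
        exact ⟨A.ominus a u, m.map_ominus a u⟩
      refine CFun.surjective_multiplication hA hd hL ho
        (CFun.locallySeparates_multiplication hL ho ?_)
      intro x y hxy
      obtain ⟨a, ha⟩ := CFun.exists_lt_of_isInitialCone hsep hinit hxy
      exact ⟨_, ⟨a, rfl⟩, ha⟩
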